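/- Let $\mathbb K$ be $\mathbb R$ or $\mathbb C$. For a Banach space $X$ over $\mathbb K$ with closed unit ball $B_X$ and unit sphere $S_X$, a real $\alpha>0$ and an integer $n\ge 1$, put $$S^\alpha(X):=\Bigl\{\tfrac{x+y}{2}: x,y\in B_X,\ \|x-y\|\ge\alpha\Bigr\},$$ $$S^\alpha_n(X):=\Bigl\{\sum_{i=1}^n\lambda_i z_i:\ \lambda_1,\dots,\lambda_n\in[0,1],\ \sum_{i=1}^n\lambda_i=1,\ z_1,\dots,z_n\in S^\alpha(X)\Bigr\},$$ $$C_n^\alpha(X):=\sup_{x\in S_X}\ \inf_{y\in S_n^\alpha(X)}\|x-y\|$$ (with $\inf\emptyset=\infty$). The space $X$ has the uniform slice diameter two property (uniform slice-D2P) if $\lim_{n\to\infty}C_n^\alpha(X)=0$ for every $0<\alpha<2$. A uniform algebra over a compact Hausdorff space $K$ is a subalgebra of the algebra $\mathcal C(K)$ of continuous functions $K\to\mathbb K$ which is closed in the supremum norm, contains the constant functions and separates the points of $K$; it is regarded as a Banach space over $\mathbb K$ with the supremum norm. Let $X$ be an infinite-dimensional uniform algebra over a compact Hausdorff space $K$.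 Then $$C_n^{\frac{2}{1+4\delta}}(X)\le\frac1n+5\delta\qquad\text{for every integer } n\ge1 \text{ and every } \delta>0,$$ and $X$ has the uniform slice-D2P. -/

import Mathlib

open Filter Topology
open scoped ENNReal

section UniformSlice

variable (𝕜 : Type*) [RCLike 𝕜]

/-- `conv_n(C)`: the convex combinations (with real weights) of `n` elements of `C`,
repetitions and zero weights being allowed. -/
def convN {E : Type*} [AddCommGroup E] [Module 𝕜 E] (n : ℕ) (C : Set E) : Set E :=
  {z | ∃ (w : Fin n → ℝ) (x : Fin n → E),
    (∀ i, w i ∈ Set.Icc (0 : ℝ) 1) ∧ ∑ i, w i = 1 ∧ (∀ i, x i ∈ C) ∧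
      z = ∑ i, ((w i : ℝ) : 𝕜) • x i}

variable (X : Type*) [NormedAddCommGroup X] [NormedSpace 𝕜 X]

/-- `S^α(X)`: the midpoints of pairs of points of the closed unit ball at distance at least `α`. -/
def midSet (α : ℝ) : Set X :=
  {z | ∃ x y : X, ‖x‖ ≤ 1 ∧ ‖y‖ ≤ 1 ∧ α ≤ ‖x - y‖ ∧ z = (2⁻¹ : 𝕜) • (x + y)}

/-- `C_n^α(X)`: the supremum over the unit sphere of the distance to `conv_n(S^α(X))`.
It takes values in `[0, ∞]`, so that the distance to an empty set is `∞`. -/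
noncomputable def sliceConst (n : ℕ) (α : ℝ) : ℝ≥0∞ :=
  ⨆ x ∈ Metric.sphere (0 : X) 1, Metric.infEDist x (convN 𝕜 n (midSet 𝕜 X α))

/-- The uniform slice diameter two property. -/
def UniformSliceD2P : Prop :=
  ∀ α : ℝ, 0 < α → α < 2 → Tendsto (fun n : ℕ => sliceConst 𝕜 X n α) atTop (𝓝 0)

end UniformSlice

/-- A uniform algebra over the compact Hausdorff space `K`: a closed subalgebra of `C(K, 𝕜)` which
separates the points of `K`. (A `Subalgebra` contains the constant functions.) -/
structure IsUniformAlgebra {𝕜 K : Type*} [RCLike 𝕜] [TopologicalSpace K] [CompactSpace K]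
    [T2Space K] (A : Subalgebra 𝕜 C(K, 𝕜)) : Prop where
  isClosed : IsClosed (A : Set C(K, 𝕜))
  separatesPoints : A.SeparatesPoints

/-! Let `h 0, …, h (n-1)` in the algebra take the value 1, have range near `[0,1]` in the sense `|h
i| + |1 - h i| ≤ 1 + η`, and be almost disjoint on a norm-attaining set. For `‖f‖ ≤ 1`, the
functions `f (1 - h i) ± h i` have norm at most `1 + η` and differ by `2 h i`, of norm at least 2.
After division by `1 + η` their midpoint lies in `S^α` with `α = 2/(1+η)`. Averaging these midpoints
over `i` changes `f` by about `f · (1/n) ∑ h i`, which is of size about `1/n` by almost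
disjointness.

The `h i` come from `exists_almost_disjoint_peaks`. A minimal closed norm-attaining set is infinite,
hence has disjoint nonempty relatively open pieces. Minimality gives a function peaking on each
piece, and powers make it small on the rest of the set. Composition with the normalised logarithm of
`exists_powerSeries_thin_range` flattens the range towards `[0,1]`, keeping the value 1 and not
increasing moduli. -/

/-- Every `RCLike` field embeds isometrically into `ℂ`. -/
lemma RCLike.exists_isometric_ringHom_complex (𝕜 : Type*) [RCLike 𝕜] :
    ∃ ι : 𝕜 →+* ℂ, (∀ x, ‖ι x‖ = ‖x‖) ∧ ∀ r : ℝ, ι (r : 𝕜) = (r : ℂ) := by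
  rcases RCLike.I_eq_zero_or_im_I_eq_one (K := 𝕜) with h | h
  · refine ⟨Complex.ofRealHom.comp (RCLike.realRingEquiv h).toRingHom, fun x => ?_, fun r => ?_⟩
    · have hx : x = ((RCLike.re x : ℝ) : 𝕜) := by
        conv_lhs => rw [← RCLike.re_add_im x, h]
        simp
      conv_rhs => rw [hx]
      simp [RCLike.realRingEquiv]
    · simp [RCLike.realRingEquiv]
  · refine ⟨(RCLike.complexRingEquiv h).toRingHom, fun x => ?_, fun r => ?_⟩
    · exact (RCLike.complexLinearIsometryEquiv h).norm_map x
    · simp [RCLike.complexRingEquiv]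

/-- The normalised logarithm `log (1 - r t) / log (1 - r)` maps the unit disc into a thin
neighbourhood of the unit interval. -/
lemma norm_add_norm_one_sub_log_le {r : ℝ} (h0 : 0 < r) (h1 : r < 1) {t : ℂ} (ht : ‖t‖ ≤ 1)
    {z : ℂ} (hz : z = ((-Real.log (1 - r))⁻¹ : ℝ) * -Complex.log (1 - r * t)) (hz1 : ‖z‖ ≤ 1) :
    ‖z‖ + ‖1 - z‖ ≤ 1 + 6 / (-Real.log (1 - r)) := by
  set L := -Real.log (1 - r) with hL
  have hLpos : 0 < L := by
    have := Real.log_neg (by linarith : 0 < 1 - r) (by linarith)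
    linarith
  have hrt : ‖(r : ℂ) * t‖ ≤ r := by
    rw [norm_mul, Complex.norm_real, Real.norm_of_nonneg h0.le]
    nlinarith [norm_nonneg t]
  have hre : 0 < (1 - (r : ℂ) * t).re := by
    have := (Complex.re_le_norm ((r : ℂ) * t)).trans hrt
    rw [Complex.sub_re, Complex.one_re]
    linarith
  -- `1 - r t` lies in the right half-plane, so its argument is below `π/2 ≤ 2`.
  have him : |z.im| ≤ 2 / L := by
    rw [hz, Complex.im_ofReal_mul, Complex.neg_im, Complex.log_im, abs_mul, abs_neg,
      abs_of_pos (inv_pos.2 hLpos), div_eq_inv_mul]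
    gcongr
    exact ((Complex.abs_arg_lt_pi_div_two_iff.2 (Or.inl hre)).le).trans
      (by linarith [Real.pi_le_four])
  have hzre : -(1 / L) ≤ z.re := by
    rw [hz, Complex.re_ofReal_mul, Complex.neg_re, Complex.log_re, one_div, mul_neg, neg_le_neg_iff]
    have hn : ‖1 - (r : ℂ) * t‖ ≤ 2 := by
      refine (norm_sub_le _ _).trans ?_
      rw [norm_one]; linarith
    have hp : 0 < ‖1 - (r : ℂ) * t‖ := hre.trans_le (Complex.re_le_norm _)
    have := Real.log_le_sub_one_of_pos hp
    exact mul_le_of_le_one_right (inv_pos.2 hLpos).le (by linarith)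
  have hzre1 : z.re ≤ 1 := (Complex.re_le_norm z).trans hz1
  have e1 := Complex.norm_le_abs_re_add_abs_im z
  have e2 := Complex.norm_le_abs_re_add_abs_im (1 - z)
  rw [Complex.sub_re, Complex.one_re, Complex.sub_im, Complex.one_im, zero_sub, abs_neg,
    abs_of_nonneg (by linarith : 0 ≤ 1 - z.re)] at e2
  have e3 : |z.re| ≤ z.re + 2 * (1 / L) := by
    have : 0 < 1 / L := by positivity
    rw [abs_le]; constructor <;> linarith
  have e4 : 6 / L = 2 * (2 / L) + 2 * (1 / L) := by ring
  linarith

/-- There are power series with nonnegative coefficients summing to one and vanishing at zero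
which map the unit disc into an arbitrarily thin neighbourhood of the unit interval. -/
lemma exists_powerSeries_thin_range (𝕜 : Type*) [RCLike 𝕜] {η : ℝ} (hη : 0 < η) :
    ∃ c : ℕ → ℝ, (∀ k, 0 ≤ c k) ∧ c 0 = 0 ∧ HasSum c 1 ∧
      ∀ t z : 𝕜, ‖t‖ ≤ 1 → HasSum (fun k => (c k : 𝕜) * t ^ k) z → ‖z‖ + ‖1 - z‖ ≤ 1 + η := by
  -- Chosen so that `-log (1 - r) = 6 / η`, which turns the error `6 / L` into `η`.
  set r : ℝ := 1 - Real.exp (-(6 / η)) with hr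
  have h1 : r < 1 := by linarith [Real.exp_pos (-(6 / η))]
  have h0 : 0 < r := by
    have : Real.exp (-(6 / η)) < 1 := by
      rw [← Real.exp_zero]
      exact Real.exp_lt_exp.2 (neg_lt_zero.2 (by positivity))
    linarith
  have hL : -Real.log (1 - r) = 6 / η := by rw [hr, sub_sub_cancel, Real.log_exp, neg_neg]
  have hLpos : 0 < -Real.log (1 - r) := by rw [hL]; positivity
  set c : ℕ → ℝ := fun k => (-Real.log (1 - r))⁻¹ * (r ^ k / k) with hc
  have hcsum : HasSum c 1 := by
    have h := (Complex.hasSum_taylorSeries_neg_log (z := (r : ℂ))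
      (by rwa [Complex.norm_real, Real.norm_of_nonneg h0.le]))
    have e : -Complex.log (1 - (r : ℂ)) = ((-Real.log (1 - r) : ℝ) : ℂ) := by
      rw [Complex.ofReal_neg, Complex.ofReal_log (by linarith)]; simp
    rw [e] at h
    have h2 : HasSum (fun k : ℕ => r ^ k / k) (-Real.log (1 - r)) := by
      rw [← Complex.hasSum_ofReal]
      simpa using h
    have h3 := h2.mul_left (-Real.log (1 - r))⁻¹
    rwa [inv_mul_cancel₀ hLpos.ne'] at h3
  have hcnn : ∀ k, 0 ≤ c k := fun k => by positivity
  refine ⟨c, hcnn, by simp [hc], hcsum, fun t z ht hz => ?_⟩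
  obtain ⟨ι, hι, hιr⟩ := RCLike.exists_isometric_ringHom_complex 𝕜
  have hιc : Continuous ι := (AddMonoidHomClass.isometry_of_norm ι hι).continuous
  have hz1 : ‖z‖ ≤ 1 := hz.norm_le_of_bounded hcsum fun k => by
    rw [norm_mul, RCLike.norm_ofReal, abs_of_nonneg (hcnn k), norm_pow]
    exact mul_le_of_le_one_right (hcnn k) (pow_le_one₀ (norm_nonneg _) ht)
  have hzι : HasSum (fun k => (c k : ℂ) * ι t ^ k) (ι z) := by
    have := hz.map ι hιc
    simpa [Function.comp_def, hιr] using this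
  have hlog := (Complex.hasSum_taylorSeries_neg_log (z := (r : ℂ) * ι t) (by
    rw [norm_mul, Complex.norm_real, Real.norm_of_nonneg h0.le, hι]
    nlinarith [norm_nonneg t])).mul_left (((-Real.log (1 - r))⁻¹ : ℝ) : ℂ)
  have hval := hzι.unique (hlog.congr_fun fun k => by simp [hc, mul_pow]; ring)
  have key := norm_add_norm_one_sub_log_le h0 h1 (t := ι t) (by rwa [hι]) hval (by rwa [hι])
  have e : 1 - ι z = ι (1 - z) := by simp
  rw [e, hι, hι, hL] at key
  have : 6 / (6 / η) = η := by field_simp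
  rwa [this] at key

/-! ### Norm-attaining sets and almost disjoint peak functions -/

section NormAttaining

variable {𝕜 K : Type*} [RCLike 𝕜] [TopologicalSpace K] [CompactSpace K]

/-- A norm-attaining set of `A`: every element of `A` attains its norm on it. -/
def IsBoundarySet (A : Subalgebra 𝕜 C(K, 𝕜)) (B : Set K) : Prop :=
  ∀ f ∈ A, ∃ x ∈ B, ‖f x‖ = ‖f‖

lemma IsBoundarySet.norm_le {A : Subalgebra 𝕜 C(K, 𝕜)} {B : Set K} (hB : IsBoundarySet A B)
    {f : C(K, 𝕜)} (hf : f ∈ A) {M : ℝ} (h : ∀ x ∈ B, ‖f x‖ ≤ M) : ‖f‖ ≤ M := by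
  obtain ⟨x, hx, hxf⟩ := hB f hf
  exact hxf ▸ h x hx

lemma isBoundarySet_univ [Nonempty K] (A : Subalgebra 𝕜 C(K, 𝕜)) :
    IsBoundarySet A Set.univ := fun f _ => by
  obtain ⟨x, hx⟩ := (continuous_norm.comp f.continuous).exists_forall_ge_of_hasCompactSupport
    (HasCompactSupport.of_compactSpace _)
  exact ⟨x, trivial, le_antisymm (f.norm_coe_le_norm x) ((f.norm_le (norm_nonneg _)).2 hx)⟩

/-- A minimal closed boundary set exists. -/
lemma exists_minimal_isBoundarySet [Nonempty K] (A : Subalgebra 𝕜 C(K, 𝕜)) :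
    ∃ B : Set K, Minimal (· ∈ {B : Set K | IsClosed B ∧ IsBoundarySet A B}) B := by
  refine zorn_superset _ fun c hcS hc => ?_
  rcases c.eq_empty_or_nonempty with rfl | hne
  · exact ⟨Set.univ, ⟨isClosed_univ, isBoundarySet_univ A⟩, by simp⟩
  refine ⟨⋂₀ c, ⟨isClosed_sInter fun s hs => (hcS hs).1, fun f hf => ?_⟩,
    fun s hs => Set.sInter_subset_of_mem hs⟩
  have hcl : IsClosed {x : K | ‖f x‖ = ‖f‖} := isClosed_eq (by fun_prop) continuous_const
  have : Nonempty c := hne.to_subtype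
  -- Each member of the chain meets the closed set where `|f|` is maximal; compactness gives a
  -- common point.
  obtain ⟨x, hx⟩ := IsCompact.nonempty_iInter_of_directed_nonempty_isCompact_isClosed
    (fun s : c => (s : Set K) ∩ {x : K | ‖f x‖ = ‖f‖})
    (fun s t => by
      rcases hc.total s.2 t.2 with h | h
      · exact ⟨s, subset_rfl, Set.inter_subset_inter_left _ h⟩
      · exact ⟨t, Set.inter_subset_inter_left _ h, subset_rfl⟩)
    (fun s => by
      obtain ⟨x, hx, hxf⟩ := (hcS s.2).2 f hf
      exact ⟨x, hx, hxf⟩)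
    (fun s => ((hcS s.2).1.inter hcl).isCompact)
    (fun s => (hcS s.2).1.inter hcl)
  rw [Set.mem_iInter] at hx
  exact ⟨x, fun s hs => (hx ⟨s, hs⟩).1, (hx ⟨_, hne.some_mem⟩).2⟩

/-- A boundary set of an infinite-dimensional algebra is infinite. -/
lemma IsBoundarySet.infinite {A : Subalgebra 𝕜 C(K, 𝕜)} {B : Set K} (hB : IsBoundarySet A B)
    (hdim : ¬ FiniteDimensional 𝕜 A) : B.Infinite := fun hfin => hdim <| by
  have : Finite B := hfin
  let T : A →ₗ[𝕜] (B → 𝕜) :=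
    { toFun := fun f x => (f : C(K, 𝕜)) x
      map_add' := fun _ _ => rfl
      map_smul' := fun _ _ => rfl }
  refine FiniteDimensional.of_injective T ((injective_iff_map_eq_zero T).2 fun f hf => ?_)
  have : ‖(f : C(K, 𝕜))‖ ≤ 0 := hB.norm_le f.2 fun x hx => by
    have : (f : C(K, 𝕜)) x = 0 := congrFun hf ⟨x, hx⟩
    simp [this]
  exact Subtype.ext (norm_le_zero_iff.1 this)

/-- Near each point of a minimal closed boundary set there are functions attaining the value one
and uniformly small on the rest of that set. -/
lemma exists_peak_of_minimal {A : Subalgebra 𝕜 C(K, 𝕜)} {B : Set K}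
    (hB : Minimal (· ∈ {B : Set K | IsClosed B ∧ IsBoundarySet A B}) B) {U : Set K}
    (hU : IsOpen U) (hBU : (B ∩ U).Nonempty) {ε : ℝ} (hε : 0 < ε) :
    ∃ g ∈ A, ‖g‖ ≤ 1 ∧ (∃ x, g x = 1) ∧ ∀ x ∈ B \ U, ‖g x‖ ≤ ε := by
  obtain ⟨p, hpB, hpU⟩ := hBU
  have hcl : IsClosed (B \ U) := hB.prop.1.sdiff hU
  have hnot : ¬ IsBoundarySet A (B \ U) := fun h =>
    (hB.le_of_le ⟨hcl, h⟩ Set.sdiff_subset hpB).2 hpU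
  simp only [IsBoundarySet, not_forall, not_exists, not_and] at hnot
  obtain ⟨f, hf, hfne⟩ := hnot
  have hlt : ∀ x ∈ B \ U, ‖f x‖ < ‖f‖ := fun x hx =>
    lt_of_le_of_ne (f.norm_coe_le_norm x) (hfne x hx)
  obtain ⟨q, hqB, hq⟩ := hB.prop.2 f hf
  -- If `f = 0`, the strict inequality forces `B \ U` to be empty, and the constant 1 serves.
  by_cases hf0 : f = 0
  · refine ⟨1, A.one_mem, ?_, ⟨p, rfl⟩, fun x hx => ?_⟩
    · exact (ContinuousMap.norm_le _ zero_le_one).2 fun x => by simp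
    · exact absurd (hlt x hx) (by simp [hf0])
  have hfpos : 0 < ‖f‖ := norm_pos_iff.2 hf0
  have hq0 : f q ≠ 0 := norm_pos_iff.1 (hq ▸ hfpos)
  set g : C(K, 𝕜) := (f q)⁻¹ • f with hg
  have hgA : g ∈ A := A.smul_mem hf _
  have hgx : ∀ x, ‖g x‖ = ‖f x‖ / ‖f‖ := fun x => by
    simp [hg, hq, div_eq_inv_mul]
  have hgq : g q = 1 := by simp [hg, hq0]
  have hg1 : ∀ x, ‖g x‖ ≤ 1 := fun x => by
    rw [hgx]; exact div_le_one_of_le₀ (f.norm_coe_le_norm x) (norm_nonneg _)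
  obtain ⟨s, hs0, hs1, hs⟩ : ∃ s : ℝ, 0 ≤ s ∧ s < 1 ∧ ∀ x ∈ B \ U, ‖g x‖ ≤ s := by
    rcases (B \ U).eq_empty_or_nonempty with he | hne
    · exact ⟨0, le_rfl, zero_lt_one, by simp [he]⟩
    · obtain ⟨y, hy, hmax⟩ := hcl.isCompact.exists_isMaxOn hne
        (continuous_norm.comp g.continuous).continuousOn
      refine ⟨‖g y‖, norm_nonneg _, ?_, fun x hx => hmax hx⟩
      rw [hgx]
      exact (div_lt_one hfpos).2 (hlt y hy)
  obtain ⟨m, hm⟩ := exists_pow_lt_of_lt_one hε hs1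
  refine ⟨g ^ m, A.pow_mem hgA m, ?_, ⟨q, by simp [hgq]⟩, fun x hx => ?_⟩
  · exact (ContinuousMap.norm_le _ zero_le_one).2 fun x => by
      simpa using pow_le_one₀ (norm_nonneg _) (hg1 x)
  · rw [ContinuousMap.pow_apply, norm_pow]
    exact (pow_le_pow_left₀ (norm_nonneg _) (hs x hx) m).trans hm.le

/-- The composition of an element of the unit ball of a closed algebra with an absolutely
convergent power series is in the algebra. -/
lemma exists_mem_hasSum_pow {A : Subalgebra 𝕜 C(K, 𝕜)} (hA : IsClosed (A : Set C(K, 𝕜)))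
    {c : ℕ → ℝ} (hc : ∀ k, 0 ≤ c k) (hsum : Summable c) {g : C(K, 𝕜)} (hg : g ∈ A)
    (hg1 : ‖g‖ ≤ 1) :
    ∃ h ∈ A, ∀ x, HasSum (fun k => (c k : 𝕜) * g x ^ k) (h x) := by
  have hs : Summable fun k => (c k : 𝕜) • g ^ k := by
    refine Summable.of_norm_bounded hsum fun k => ?_
    rw [norm_smul, RCLike.norm_ofReal, abs_of_nonneg (hc k)]
    refine mul_le_of_le_one_right (hc k) ((ContinuousMap.norm_le _ zero_le_one).2 fun x => ?_)
    rw [ContinuousMap.pow_apply, norm_pow]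
    exact pow_le_one₀ (norm_nonneg _) ((g.norm_coe_le_norm x).trans hg1)
  refine ⟨∑' k, (c k : 𝕜) • g ^ k, hA.mem_of_tendsto hs.hasSum (Filter.Eventually.of_forall
    fun s => A.sum_mem fun k _ => A.smul_mem (A.pow_mem hg k) _), fun x => ?_⟩
  exact ContinuousMap.hasSum_apply hs.hasSum x

/-- In an infinite-dimensional closed algebra there are arbitrarily many almost disjoint
functions attaining the value one, with range near the unit interval on a boundary set. -/
lemma exists_almost_disjoint_peaks [T2Space K] {A : Subalgebra 𝕜 C(K, 𝕜)}
    (hA : IsClosed (A : Set C(K, 𝕜))) (hdim : ¬ FiniteDimensional 𝕜 A) (n : ℕ)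
    {η ε : ℝ} (hη : 0 < η) (hε : 0 < ε) :
    ∃ (B : Set K) (h : Fin n → C(K, 𝕜)), IsBoundarySet A B ∧ (∀ i, h i ∈ A) ∧
      (∀ i, ∃ x, h i x = 1) ∧ (∀ i x, ‖h i x‖ + ‖1 - h i x‖ ≤ 1 + η) ∧
      ∀ x ∈ B, ∑ i, ‖h i x‖ ≤ 1 + n * ε := by
  have : Nonempty K := by
    by_contra hK
    rw [not_nonempty_iff] at hK
    have : Subsingleton C(K, 𝕜) := ⟨fun f g => ContinuousMap.ext fun x => hK.elim x⟩
    exact hdim inferInstance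
  obtain ⟨B, hB⟩ := exists_minimal_isBoundarySet A
  have hinf := hB.prop.2.infinite hdim
  have := hinf.to_subtype
  obtain ⟨V, hVi, hVo, hVd⟩ := exists_seq_infinite_isOpen_pairwise_disjoint B
  choose U hUo hUV using fun i => isOpen_induced_iff.1 (hVo i)
  obtain ⟨c, hc, hc0, hc1, hcη⟩ := exists_powerSeries_thin_range 𝕜 hη
  have hpeak : ∀ i, ∃ g ∈ A, ‖g‖ ≤ 1 ∧ (∃ x, g x = 1) ∧ ∀ x ∈ B \ U i, ‖g x‖ ≤ ε := fun i => by
    obtain ⟨x, hx⟩ := (hVi i).nonempty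
    exact exists_peak_of_minimal hB (hUo i) ⟨x, x.2, by rwa [← hUV i] at hx⟩ hε
  choose g hgA hg1 hgx hgε using hpeak
  choose h hhA hh using fun i => exists_mem_hasSum_pow hA hc hc1.summable (hgA i) (hg1 i)
  have hgle : ∀ i x, ‖g i x‖ ≤ 1 := fun i x => ((g i).norm_coe_le_norm x).trans (hg1 i)
  -- As `c 0 = 0`, every term carries a factor `g i x`; smallness of `g i` off `U i` thus passes to
  -- `h i`.
  have hhg : ∀ i x, ‖h i x‖ ≤ ‖g i x‖ := fun i x => by
    have hs := hc1.mul_right ‖g i x‖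
    rw [one_mul] at hs
    refine (hh i x).norm_le_of_bounded hs fun k => ?_
    rw [norm_mul, RCLike.norm_ofReal, abs_of_nonneg (hc k), norm_pow]
    rcases k with _ | k
    · simp [hc0]
    · exact mul_le_mul_of_nonneg_left
        (pow_le_of_le_one (norm_nonneg _) (hgle i x) k.succ_ne_zero) (hc _)
  refine ⟨B, fun i => h i, hB.prop.2, fun i => hhA i, fun i => ?_,
    fun i x => hcη _ _ (hgle i x) (hh i x), fun x hx => ?_⟩
  · obtain ⟨x, hx⟩ := hgx i
    have hs := hh i x
    simp only [hx, one_pow, mul_one] at hs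
    exact ⟨x, hs.unique (by simpa using RCLike.hasSum_ofReal (𝕜 := 𝕜) |>.2 hc1)⟩
  · classical
    have hbound : ∀ i : Fin n, ‖h i x‖ ≤ (if x ∈ U i then 1 else 0) + ε := fun i => by
      split_ifs with hxi
      · linarith [hhg i x, hgle i x]
      · linarith [hhg i x, hgε i x ⟨hx, hxi⟩]
    have hcard : (Finset.univ.filter fun i : Fin n => x ∈ U i).card ≤ 1 := by
      refine Finset.card_le_one.2 fun i hi j hj => Fin.ext ?_
      by_contra hij
      have hdisj : Disjoint (V i) (V j) := hVd hij
      refine Set.disjoint_left.1 hdisj (show (⟨x, hx⟩ : B) ∈ V i from ?_) ?_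
      · rw [← hUV]; exact (Finset.mem_filter.1 hi).2
      · rw [← hUV]; exact (Finset.mem_filter.1 hj).2
    calc ∑ i : Fin n, ‖h i x‖ ≤ ∑ i : Fin n, ((if x ∈ U i then 1 else 0) + ε) :=
          Finset.sum_le_sum fun i _ => hbound i
      _ = ((Finset.univ.filter fun i : Fin n => x ∈ U i).card : ℝ) + n * ε := by
          rw [Finset.sum_add_distrib, Finset.sum_boole]; simp
      _ ≤ 1 + n * ε := by gcongr; exact_mod_cast hcard

end NormAttaining

/-- The constants `C_n^α(X)` increase with `α`. -/
lemma sliceConst_mono (𝕜 : Type*) [RCLike 𝕜] (X : Type*) [NormedAddCommGroup X]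
    [NormedSpace 𝕜 X] (n : ℕ) {α β : ℝ} (h : α ≤ β) :
    sliceConst 𝕜 X n α ≤ sliceConst 𝕜 X n β := by
  refine iSup₂_mono fun x _ => Metric.infEDist_anti ?_
  rintro z ⟨w, y, hw, hw1, hy, rfl⟩
  refine ⟨w, y, hw, hw1, fun i => ?_, rfl⟩
  obtain ⟨a, b, ha, hb, hab, hz⟩ := hy i
  exact ⟨a, b, ha, hb, h.trans hab, hz⟩

/-! ### Midpoints built from peak functions, and their average -/

section Peaks

variable {𝕜 K : Type*} [RCLike 𝕜] [TopologicalSpace K] [CompactSpace K]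

lemma norm_smul_mul_one_sub_add_le {f h : C(K, 𝕜)} {η : ℝ} (hη : 0 < η)
    (hf : ‖f‖ ≤ 1) (hh : ∀ x, ‖h x‖ + ‖1 - h x‖ ≤ 1 + η) {σ : 𝕜} (hσ : ‖σ‖ = 1) :
    ‖(((1 + η)⁻¹ : ℝ) : 𝕜) • (f * (1 - h) + σ • h)‖ ≤ 1 := by
  refine (ContinuousMap.norm_le _ zero_le_one).2 fun x => ?_
  have hs : 0 < (1 + η)⁻¹ := by positivity
  simp only [ContinuousMap.smul_apply, ContinuousMap.add_apply, ContinuousMap.mul_apply,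
    ContinuousMap.sub_apply, ContinuousMap.one_apply]
  rw [norm_smul, RCLike.norm_ofReal, abs_of_pos hs]
  refine (mul_le_mul_of_nonneg_left ((norm_add_le _ _).trans ?_) hs.le).trans_eq
    (inv_mul_cancel₀ (by positivity : 1 + η ≠ 0))
  rw [norm_mul, norm_smul, hσ, one_mul]
  have := mul_le_of_le_one_left (norm_nonneg (1 - h x)) ((f.norm_coe_le_norm x).trans hf)
  linarith [hh x]

/-- Perturbing `f` by `±h` near the peak of `h` exhibits a multiple of `f (1 - h)` as a midpoint. -/
lemma smul_mul_one_sub_mem_midSet {A : Subalgebra 𝕜 C(K, 𝕜)} {f h : C(K, 𝕜)} (hfA : f ∈ A)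
    (hhA : h ∈ A) {η : ℝ} (hη : 0 < η) (hf : ‖f‖ ≤ 1) (hh : ∀ x, ‖h x‖ + ‖1 - h x‖ ≤ 1 + η)
    (hpeak : ∃ x, h x = 1)
    (hmem : (((1 + η)⁻¹ : ℝ) : 𝕜) • (f * (1 - h)) ∈ A) :
    (⟨_, hmem⟩ : A) ∈ midSet 𝕜 A (2 / (1 + η)) := by
  have hmemσ : ∀ σ : 𝕜, (((1 + η)⁻¹ : ℝ) : 𝕜) • (f * (1 - h) + σ • h) ∈ A := fun σ =>
    A.smul_mem (A.add_mem (A.mul_mem hfA (A.sub_mem A.one_mem hhA)) (A.smul_mem hhA σ)) _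
  refine ⟨⟨_, hmemσ 1⟩, ⟨_, hmemσ (-1)⟩, norm_smul_mul_one_sub_add_le hη hf hh (by simp),
    norm_smul_mul_one_sub_add_le hη hf hh (by simp), ?_, Subtype.ext ?_⟩
  · obtain ⟨x, hx⟩ := hpeak
    have e : (((1 + η)⁻¹ : ℝ) : 𝕜) • (f * (1 - h) + (1 : 𝕜) • h) -
        (((1 + η)⁻¹ : ℝ) : 𝕜) • (f * (1 - h) + (-1 : 𝕜) • h) = ((2 / (1 + η) : ℝ) : 𝕜) • h := by
      ext y
      simp only [ContinuousMap.smul_apply, ContinuousMap.add_apply, ContinuousMap.mul_apply,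
        ContinuousMap.sub_apply, ContinuousMap.one_apply, smul_eq_mul]
      push_cast
      ring
    have h2 := ContinuousMap.norm_coe_le_norm (((2 / (1 + η) : ℝ) : 𝕜) • h) x
    rw [ContinuousMap.smul_apply, hx, norm_smul, norm_one, mul_one, RCLike.norm_ofReal,
      abs_of_pos (by positivity), ← e] at h2
    exact h2
  · change (((1 + η)⁻¹ : ℝ) : 𝕜) • (f * (1 - h)) =
      (2⁻¹ : 𝕜) • ((((1 + η)⁻¹ : ℝ) : 𝕜) • (f * (1 - h) + (1 : 𝕜) • h) +
        (((1 + η)⁻¹ : ℝ) : 𝕜) • (f * (1 - h) + (-1 : 𝕜) • h))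
    ext y
    simp only [ContinuousMap.smul_apply, ContinuousMap.add_apply, ContinuousMap.mul_apply,
      ContinuousMap.sub_apply, ContinuousMap.one_apply, smul_eq_mul]
    ring

/-- With `s = (1 + η)⁻¹`, the difference is `f x` times `(1 - s) + (s/n) ∑ h i x`. Rescaling costs
`1 - s ≤ η`, and the sum costs `1/n + δ`. -/
lemma norm_sub_average_apply_le {n : ℕ} (hn : 1 ≤ n) {f : C(K, 𝕜)} (hf : ‖f‖ ≤ 1)
    {h : Fin n → C(K, 𝕜)} {η δ : ℝ} (hη : 0 < η) (hδ : 0 < δ) {x : K}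
    (hh : ∑ i, ‖h i x‖ ≤ 1 + n * δ) :
    ‖f x - ∑ i, (((n : ℝ)⁻¹ : ℝ) : 𝕜) * ((((1 + η)⁻¹ : ℝ) : 𝕜) * (f x * (1 - h i x)))‖ ≤
      1 / n + δ + η := by
  have hn0 : (0 : ℝ) < n := by exact_mod_cast hn
  have hn' : (n : 𝕜) ≠ 0 := by exact_mod_cast hn0.ne'
  set s : ℝ := (1 + η)⁻¹ with hs
  have hs0 : 0 < s := by positivity
  have hs1 : s ≤ 1 := inv_le_one_of_one_le₀ (by linarith)
  have hsη : s * (1 + η) = 1 := inv_mul_cancel₀ (by positivity)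
  have e : f x - ∑ i, (((n : ℝ)⁻¹ : ℝ) : 𝕜) * ((s : 𝕜) * (f x * (1 - h i x))) =
      f x * (((1 - s : ℝ) : 𝕜) + (s : 𝕜) * (((n : ℝ)⁻¹ : ℝ) : 𝕜) * ∑ i, h i x) := by
    rw [← Finset.mul_sum, ← Finset.mul_sum, ← Finset.mul_sum, Finset.sum_sub_distrib]
    simp only [Finset.sum_const, Finset.card_univ, Fintype.card_fin, nsmul_eq_mul, mul_one]
    push_cast
    field_simp
    ring
  rw [e, norm_mul]
  refine (mul_le_of_le_one_left (norm_nonneg _) ((f.norm_coe_le_norm x).trans hf)).trans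
    ((norm_add_le _ _).trans ?_)
  rw [norm_mul, norm_mul, RCLike.norm_ofReal, RCLike.norm_ofReal, RCLike.norm_ofReal,
    abs_of_nonneg (by linarith), abs_of_pos hs0, abs_of_pos (inv_pos.2 hn0)]
  have h1 : 1 - s ≤ η := by nlinarith
  have h2 : s * (n : ℝ)⁻¹ * ‖∑ i, h i x‖ ≤ 1 / n + δ := by
    calc s * (n : ℝ)⁻¹ * ‖∑ i, h i x‖ ≤ 1 * (n : ℝ)⁻¹ * (1 + n * δ) := by
          gcongr
          exact (norm_sum_le _ _).trans hh
      _ = 1 / n + δ := by field_simp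
  linarith

/-- Range tolerance `4 δ` and disjointness tolerance `δ` add up to `5 δ`. It suffices to estimate on
`B`, since `f` minus the average is in `A`. -/
lemma sliceConst_le_of_isClosed [T2Space K] {A : Subalgebra 𝕜 C(K, 𝕜)}
    (hA : IsClosed (A : Set C(K, 𝕜))) (hdim : ¬ FiniteDimensional 𝕜 A) {n : ℕ} {δ : ℝ}
    (hn : 1 ≤ n) (hδ : 0 < δ) :
    sliceConst 𝕜 A n (2 / (1 + 4 * δ)) ≤ ENNReal.ofReal (1 / (n : ℝ) + 5 * δ) := by
  have hn0 : (0 : ℝ) < n := by exact_mod_cast hn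
  have hη : 0 < 4 * δ := by positivity
  obtain ⟨B, h, hB, hhA, hh1, hhη, hhs⟩ := exists_almost_disjoint_peaks hA hdim n hη hδ
  refine iSup₂_le fun f hf => ?_
  have hf1 : ‖(f : C(K, 𝕜))‖ ≤ 1 := (mem_sphere_zero_iff_norm.1 hf).le
  have hzA : ∀ i, (((1 + 4 * δ)⁻¹ : ℝ) : 𝕜) • ((f : C(K, 𝕜)) * (1 - h i)) ∈ A := fun i =>
    A.smul_mem (A.mul_mem f.2 (A.sub_mem A.one_mem (hhA i))) _
  let z : Fin n → A := fun i => ⟨_, hzA i⟩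
  have hz : ∀ i, z i ∈ midSet 𝕜 A (2 / (1 + 4 * δ)) := fun i =>
    smul_mul_one_sub_mem_midSet f.2 (hhA i) hη hf1 (hhη i) (hh1 i) (hzA i)
  have hmem : ∑ i, (((n : ℝ)⁻¹ : ℝ) : 𝕜) • z i ∈ convN 𝕜 n (midSet 𝕜 A (2 / (1 + 4 * δ))) :=
    ⟨fun _ => (n : ℝ)⁻¹, z, fun _ => ⟨by positivity, inv_le_one_of_one_le₀ (by exact_mod_cast hn)⟩,
      by simp [hn0.ne'], hz, rfl⟩
  refine (Metric.infEDist_le_edist_of_mem hmem).trans ?_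
  set w : A := ∑ i, (((n : ℝ)⁻¹ : ℝ) : 𝕜) • z i with hw
  have e : ∀ x, (w : C(K, 𝕜)) x = ∑ i, (((n : ℝ)⁻¹ : ℝ) : 𝕜) *
      ((((1 + 4 * δ)⁻¹ : ℝ) : 𝕜) * ((f : C(K, 𝕜)) x * (1 - h i x))) := fun x => by
    have e1 : (w : C(K, 𝕜)) = ∑ i, (((n : ℝ)⁻¹ : ℝ) : 𝕜) •
        (((1 + 4 * δ)⁻¹ : ℝ) : 𝕜) • ((f : C(K, 𝕜)) * (1 - h i)) := map_sum A.val _ _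
    rw [e1, ContinuousMap.sum_apply]
    simp only [ContinuousMap.smul_apply, ContinuousMap.mul_apply, ContinuousMap.sub_apply,
      ContinuousMap.one_apply, smul_eq_mul]
  have key : ‖(f : C(K, 𝕜)) - w‖ ≤ 1 / (n : ℝ) + 5 * δ :=
    hB.norm_le (A.sub_mem f.2 w.2) fun x hx => by
      rw [ContinuousMap.sub_apply, e]
      exact (norm_sub_average_apply_le hn hf1 hη hδ (hhs x hx)).trans (by linarith)
  rw [edist_dist]
  refine ENNReal.ofReal_le_ofReal ?_
  rwa [Subtype.dist_eq, dist_eq_norm]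

end Peaks

/-- A bound `C_n^{2/(1+4δ)} ≤ 1/n + 5δ` for all `n` and `δ` gives the uniform slice-D2P. -/
lemma uniformSliceD2P_of_sliceConst_le {𝕜 X : Type*} [RCLike 𝕜] [NormedAddCommGroup X]
    [NormedSpace 𝕜 X] (h : ∀ (n : ℕ) (δ : ℝ), 1 ≤ n → 0 < δ →
      sliceConst 𝕜 X n (2 / (1 + 4 * δ)) ≤ ENNReal.ofReal (1 / (n : ℝ) + 5 * δ)) :
    UniformSliceD2P 𝕜 X := by
  intro α hα hα2
  refine ENNReal.tendsto_nhds_zero.2 fun ε hε => ?_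
  obtain ⟨e, he0, heε⟩ := ENNReal.lt_iff_exists_real_btwn.1 hε
  have he : 0 < e := ENNReal.ofReal_pos.1 heε.1
  obtain ⟨δ, hδ0, hδ⟩ : ∃ δ : ℝ, 0 < δ ∧ δ ≤ e / 10 ∧ α * (1 + 4 * δ) ≤ 2 := by
    have h2 : 0 < (2 / α - 1) / 4 := by
      have : 1 < 2 / α := (one_lt_div hα).2 hα2
      linarith
    -- The first bound gives `5 δ ≤ e / 2`, the second `α ≤ 2 / (1 + 4 δ)`.
    refine ⟨min (e / 10) ((2 / α - 1) / 4), lt_min (by positivity) h2, min_le_left _ _, ?_⟩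
    have h3 := min_le_right (e / 10) ((2 / α - 1) / 4)
    calc α * (1 + 4 * min (e / 10) ((2 / α - 1) / 4)) ≤ α * (2 / α) := by
          gcongr; linarith
      _ = 2 := mul_div_cancel₀ _ hα.ne'
  obtain ⟨N, hN⟩ := exists_nat_one_div_lt (by positivity : 0 < e / 2)
  filter_upwards [eventually_ge_atTop (N + 1)] with n hn
  have hαδ : α ≤ 2 / (1 + 4 * δ) := (le_div_iff₀ (by positivity)).2 hδ.2
  refine (sliceConst_mono 𝕜 X n hαδ).trans ((h n δ (by omega) hδ0).trans
    ((ENNReal.ofReal_le_ofReal ?_).trans heε.2.le))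
  have : 1 / (n : ℝ) ≤ 1 / ((N : ℝ) + 1) := by
    gcongr; exact_mod_cast hn
  linarith [hδ.1]

theorem mainTheorem8 {𝕜 K : Type*} [RCLike 𝕜] [TopologicalSpace K] [CompactSpace K] [T2Space K]
    (A : Subalgebra 𝕜 C(K, 𝕜)) (hA : IsUniformAlgebra A) (hdim : ¬ FiniteDimensional 𝕜 A) :
    (∀ (n : ℕ) (δ : ℝ), 1 ≤ n → 0 < δ →
      sliceConst 𝕜 A n (2 / (1 + 4 * δ)) ≤ ENNReal.ofReal (1 / (n : ℝ) + 5 * δ)) ∧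
    UniformSliceD2P 𝕜 A := by
  have h : ∀ (n : ℕ) (δ : ℝ), 1 ≤ n → 0 < δ →
      sliceConst 𝕜 A n (2 / (1 + 4 * δ)) ≤ ENNReal.ofReal (1 / (n : ℝ) + 5 * δ) :=
    fun _ _ hn hδ => sliceConst_le_of_isClosed hA.isClosed hdim hn hδ
  exact ⟨h, uniformSliceD2P_of_sliceConst_le h⟩
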